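/- **Theorem (Determinism of reduction).** In the call-by-name calculus $\mathsf F_i^+$ with fixpoints and impredicative disjoint polymorphism defined below (terms and types up to renaming of bound variables): if $\cdot;\cdot\vdash e\Rightarrow A$, $e\hookrightarrow e_1$ and $e\hookrightarrow e_2$, then $e_1=e_2$. **Syntax.** ($i\in\mathbb Z$; $l$ a label; $X$ is bound in $B$ but not in $A$ in $\forall X{*}A.B$.) - Types $A,B,C ::= X\mid \mathsf{Int}\mid\mathsf{Top}\mid\mathsf{Bot}\mid A\,\&\,B\mid A\to B\mid \forall X{*}A.\,B\mid\{l:A\}$. - Checkable terms $p ::= \lambda x{:}A.\,e\mid\Lambda X.\,e\mid\{l=e\}$. - Expressions $e ::= p\mid x\mid i\mid\top\mid e:A\mid e_1,,e_2\mid \mathbf{fix}\,x{:}A.\,e\mid e_1\,e_2\mid e\,A\mid e.l$. - Values $v ::= p\mid p:A\mid i\mid\top\mid v_1,,v_2$. Pre-values $u ::= i\mid\top\mid e:A\mid u_1,,u_2$. - Type contexts $\Delta ::= \cdot\mid\Delta,X*A$; term contexts $\Gamma ::= \cdot\mid\Gamma,x:A$. **Well-formedness.** $\Delta\vdash A$: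 all free type variables of $A$ are in $\Delta$. $\vdash\Delta$: each type in $\Delta$ is well-formed in the part of $\Delta$ before it. $\Delta\vdash\Gamma$: all types of $\Gamma$ are well-formed in $\Delta$. In the relations below that carry a $\Delta$, all contexts and types are required to be well-formed. **Subtyping** $\Delta\vdash A<:B$ is the least reflexive and transitive relation with $A<:\mathsf{Top}$; $\mathsf{Bot}<:A$; $A\&B<:A$; $A\&B<:B$; if $A<:B$ and $A<:C$ then $A<:B\&C$; if $B_1<:A_1$ and $A_2<:B_2$ then $A_1\to A_2<:B_1\to B_2$; if $A<:B$ then $\{l:A\}<:\{l:B\}$; if $\Delta\vdash B_1<:A_1$ and $\Delta,X*B_1\vdash A_2<:B_2$ then $\Delta\vdash\forall X{*}A_1.A_2<:\forall X{*}B_1.B_2$; $(A\to B)\&(A\to C)<:A\to B\&C$; $\{l:A\}\&\{l:B\}<:\{l:A\&B\}$; $(\forall X{*}A.B)\&(\forall X{*}A.C)<:\forall X{*}A.\,B\&C$; $\mathsf{Top}<:\mathsf{Top}\to\mathsf{Top}$; $\mathsf{Top}<:\{l:\mathsf{Top}\}$; $\mathsf{Top}<:\forall X{*}\mathsf{Top}.\mathsf{Top}$;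 and $\Delta\vdash\mathsf{Top}<:X$ whenever $X*A\in\Delta$ and $\Delta\vdash A<:\mathsf{Bot}$. **Bottom-like and top-like types.** $\mathsf{Bot}$ is bottom-like; $A\&B$ is if $A$ or $B$ is. Top-likeness $\Delta\vdash\rceil A\lceil$: $\mathsf{Top}$ is top-like; $A\&B$ is if both $A$ and $B$ are; $A\to B$ and $\{l:B\}$ are if $B$ is; $\forall X{*}A.B$ is if $\Delta,X*A\vdash\rceil B\lceil$; $X$ is if $X*A\in\Delta$ with $A$ bottom-like. **Splitting** $B\lhd A\rhd C$ and **ordinary types** $A^\circ$. $A\lhd A\&B\rhd B$; if $B_1\lhd B\rhd B_2$ then $A\to B_1\lhd A\to B\rhd A\to B_2$, $\{l:B_1\}\lhd\{l:B\}\rhd\{l:B_2\}$ and $\forall X{*}A.B_1\lhd\forall X{*}A.B\rhd\forall X{*}A.B_2$. $A^\circ ::= X\mid\mathsf{Int}\mid\mathsf{Top}\mid\mathsf{Bot}\mid A\to B^\circ\mid\forall X{*}A.B^\circ\mid\{l:A^\circ\}$. **Disjointness** $\Delta\vdash A*B$ holds: (i) if $A,B$ are (in either order) two types of different kinds among $\mathsf{Int}$,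 arrow, record and universal types; (ii) if $A$ or $B$ is top-like; (iii) if $A_1\lhd A\rhd A_2$, $A_1*B$ and $A_2*B$, and symmetrically in $B$; (iv) for $X*B$ and $B*X$, if $X*A\in\Delta$ and $\Delta\vdash A<:B$; (v) for $A_1\to A_2*B_1\to B_2$, if $A_2*B_2$; (vi) for $\{l:A\}*\{l:B\}$, if $A*B$, and for $\{l_1:A\}*\{l_2:B\}$, if $l_1\neq l_2$; (vii) for $\forall X{*}A_1.A_2*\forall X{*}B_1.B_2$, if $\Delta,X*(A_1\&B_1)\vdash A_2*B_2$. **Consistency** of pre-values. Principal types: $\top:\mathsf{Top}$, $i:\mathsf{Int}$, $(e:A):A$, and $u_1,,u_2:A\&B$ if $u_1:A$, $u_2:B$. Then $i\approx i$; $(e:A)\approx(e:B)$; $u_1\approx u_2$ if $u_1:A$, $u_2:B$ and $\cdot\vdash A*B$; $u_1,,u_2\approx u$ if $u_1\approx u$ and $u_2\approx u$; $u\approx u_1,,u_2$ if $u\approx u_1$ and $u\approx u_2$. **Applicative distribution** $A\rhd B$: $A\rhd A$; if $A\rhd A_1\to A_2$ and $B\rhd B_1\to B_2$ then $A\&B\rhd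 A_1\&B_1\to A_2\&B_2$; if $A\rhd\{l:A_1\}$ and $B\rhd\{l:B_1\}$ then $A\&B\rhd\{l:A_1\&B_1\}$; if $A\rhd\forall X{*}A_1.A_2$ and $B\rhd\forall X{*}B_1.B_2$ then $A\&B\rhd\forall X{*}(A_1\&B_1).\,A_2\&B_2$. **Typing** (synthesis $\Rightarrow$, checking $\Leftarrow$; $\Delta;\Gamma\vdash$ omitted where unchanged). - $\top\Rightarrow\mathsf{Top}$; $i\Rightarrow\mathsf{Int}$; $x\Rightarrow A$ if $x:A\in\Gamma$. - $\lambda x{:}A.e\Leftarrow B_1\to B_2$ if $\Delta\vdash B_1<:A$ and $\Delta;\Gamma,x:A\vdash e\Leftarrow B_2$. - $\Lambda X.e\Leftarrow\forall X{*}A.B$ if $\Delta,X*A;\Gamma\vdash e\Leftarrow B$. $\{l=e\}\Leftarrow\{l:A\}$ if $e\Leftarrow A$. - $e_1\,e_2\Rightarrow C$ if $e_1\Rightarrow A$, $A\rhd B\to C$, $e_2\Leftarrow B$. $e\,D\Rightarrow C[X\mapsto D]$ if $e\Rightarrow A$, $A\rhd\forall X{*}B.C$, $\Delta\vdash D*B$.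 $e.l\Rightarrow B$ if $e\Rightarrow A$, $A\rhd\{l:B\}$. - $e_1,,e_2\Rightarrow A\&B$ if $e_1\Rightarrow A$, $e_2\Rightarrow B$, $\Delta\vdash A*B$. $u_1,,u_2\Rightarrow A\&B$ for pre-values with $\cdot;\cdot\vdash u_1\Rightarrow A$, $\cdot;\cdot\vdash u_2\Rightarrow B$, $u_1\approx u_2$. - $e\Leftarrow A\&B$ if $e\Leftarrow A$ and $e\Leftarrow B$. $\mathbf{fix}\,x{:}A.e\Rightarrow A$ if $\Delta;\Gamma,x:A\vdash e\Leftarrow A$. $(e:A)\Rightarrow A$ if $e\Leftarrow A$. $e\Leftarrow B$ if $e\Rightarrow A$ and $\Delta\vdash A<:B$. **Top-like value generator.** $[\![\mathsf{Top}]\!]=\top$; $[\![A\to B]\!]=(\lambda x{:}\mathsf{Top}.\top):A\to B$; $[\![\{l:A\}]\!]=\{l=\top\}:\{l:A\}$; $[\![\forall X{*}A.B]\!]=(\Lambda X.\top):\forall X{*}A.B$. **Wrapping** $e\rightsquigarrow_A u$. $e\rightsquigarrow_{A^\circ}[\![A^\circ]\!]$ if $\cdot\vdash\rceil A^\circ\lceil$;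 $e\rightsquigarrow_{A^\circ}(e:A^\circ)$ if not $\cdot\vdash\rceil A^\circ\lceil$; $e\rightsquigarrow_A u_1,,u_2$ if $B\lhd A\rhd C$, $e\rightsquigarrow_B u_1$, $e\rightsquigarrow_C u_2$. **Casting** of values $v\hookrightarrow_A v'$. $i\hookrightarrow_{\mathsf{Int}}i$; $v\hookrightarrow_{A^\circ}[\![A^\circ]\!]$ if $\cdot\vdash\rceil A^\circ\lceil$; $(p:A)\hookrightarrow_{B^\circ}(p:B^\circ)$ if $\cdot\vdash A<:B^\circ$ and not $\cdot\vdash\rceil B^\circ\lceil$; $v_1,,v_2\hookrightarrow_{A^\circ}v'$ if $v_1\hookrightarrow_{A^\circ}v'$ or $v_2\hookrightarrow_{A^\circ}v'$; $v\hookrightarrow_A v_1,,v_2$ if $B\lhd A\rhd C$, $v\hookrightarrow_B v_1$, $v\hookrightarrow_C v_2$. **Parallel application** $v\bullet arg\hookrightarrow u$, $arg ::= e\mid A\mid\{l\}$. - $((\lambda x{:}A.e):B)\bullet e'\hookrightarrow e[x\mapsto u]:D$ if $B\rhd C\to D$ and $e'\rightsquigarrow_A u$. - $((\Lambda X.e):A)\bullet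 D\hookrightarrow e[X\mapsto D]:C[X\mapsto D]$ if $A\rhd\forall X{*}B.C$. - $(\{l=e\}:A)\bullet\{l\}\hookrightarrow e:B$ if $A\rhd\{l:B\}$. - $(v_1,,v_2)\bullet arg\hookrightarrow u_1,,u_2$ if $v_1\bullet arg\hookrightarrow u_1$ and $v_2\bullet arg\hookrightarrow u_2$. **Reduction** $e\hookrightarrow e'$. - $v\,e\hookrightarrow e'$ if $v\bullet e\hookrightarrow e'$; $v\,A\hookrightarrow e'$ if $v\bullet A\hookrightarrow e'$; $v.l\hookrightarrow e'$ if $v\bullet\{l\}\hookrightarrow e'$. - $\mathbf{fix}\,x{:}A.e\hookrightarrow e[x\mapsto\mathbf{fix}\,x{:}A.e]:A$. - $v:A\hookrightarrow v'$ if the value $v$ is also a pre-value and $v\hookrightarrow_A v'$. - $e_1,,e_2\hookrightarrow e_1',,e_2'$ if $e_1\hookrightarrow e_1'$ and $e_2\hookrightarrow e_2'$. - $E[e]\hookrightarrow E[e']$ if $e\hookrightarrow e'$, where $E ::= [\,]\,e\mid[\,]\,A\mid[\,].l\mid[\,],,v\mid v,,[\,]\mid[\,]:A$. -/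

import Mathlib

namespace FiPlus

/-! Types and terms are represented with de Bruijn indices (type variables and term variables have
separate index spaces), so that syntactic equality is equality up to renaming of bound variables. -/

abbrev Label := String

/-- Types. In `all A B` (that is, `∀ X * A. B`) the variable `X` is bound in `B` only. -/
inductive Ty : Type
  | var (X : ℕ)
  | int
  | top
  | bot
  | and (A B : Ty)
  | arrow (A B : Ty)
  | all (A B : Ty)
  | rcd (l : Label) (A : Ty)

/-- Terms: `lam A e` is `λ x : A. e`, `tlam e` is `Λ X. e`, `rcd l e` is `{l = e}`, `anno e A` is
`e : A`, `merge e₁ e₂` is `e₁ ,, e₂`, and `fix A e` is `fix x : A. e`. -/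
inductive Tm : Type
  | var (x : ℕ)
  | lit (i : ℤ)
  | top
  | lam (A : Ty) (e : Tm)
  | tlam (e : Tm)
  | rcd (l : Label) (e : Tm)
  | anno (e : Tm) (A : Ty)
  | merge (e₁ e₂ : Tm)
  | fix (A : Ty) (e : Tm)
  | app (e₁ e₂ : Tm)
  | tapp (e : Tm) (A : Ty)
  | proj (e : Tm) (l : Label)

/-- Lifting of a renaming of indices under one binder. -/
def upRen (ξ : ℕ → ℕ) : ℕ → ℕ
  | 0 => 0
  | n + 1 => ξ n + 1

/-- Renaming of the type variables of a type. -/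
def Ty.rename : Ty → (ℕ → ℕ) → Ty
  | .var X, ξ => .var (ξ X)
  | .int, _ => .int
  | .top, _ => .top
  | .bot, _ => .bot
  | .and A B, ξ => .and (A.rename ξ) (B.rename ξ)
  | .arrow A B, ξ => .arrow (A.rename ξ) (B.rename ξ)
  | .all A B, ξ => .all (A.rename ξ) (B.rename (upRen ξ))
  | .rcd l A, ξ => .rcd l (A.rename ξ)

/-- Weakening of a type by one fresh type variable (index `0`). -/
def Ty.shift (A : Ty) : Ty := A.rename Nat.succ

/-- Lifting of a type substitution under a type binder. -/
def upTySubst (σ : ℕ → Ty) : ℕ → Ty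
  | 0 => .var 0
  | n + 1 => (σ n).shift

/-- Simultaneous capture-avoiding substitution of types for type variables in a type. -/
def Ty.subst : Ty → (ℕ → Ty) → Ty
  | .var X, σ => σ X
  | .int, _ => .int
  | .top, _ => .top
  | .bot, _ => .bot
  | .and A B, σ => .and (A.subst σ) (B.subst σ)
  | .arrow A B, σ => .arrow (A.subst σ) (B.subst σ)
  | .all A B, σ => .all (A.subst σ) (B.subst (upTySubst σ))
  | .rcd l A, σ => .rcd l (A.subst σ)

/-- The substitution that replaces the variable `0` by `C` and lowers the other variables. -/
def instTy (C : Ty) : ℕ → Ty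
  | 0 => C
  | n + 1 => .var n

/-- `B[X ↦ C]`, where `X` is the variable `0` of `B`. -/
def Ty.inst (B C : Ty) : Ty := B.subst (instTy C)

/-- Simultaneous capture-avoiding substitution of types for type variables in a term. -/
def Tm.tySubst : Tm → (ℕ → Ty) → Tm
  | .var x, _ => .var x
  | .lit i, _ => .lit i
  | .top, _ => .top
  | .lam A e, σ => .lam (A.subst σ) (e.tySubst σ)
  | .tlam e, σ => .tlam (e.tySubst (upTySubst σ))
  | .rcd l e, σ => .rcd l (e.tySubst σ)
  | .anno e A, σ => .anno (e.tySubst σ) (A.subst σ)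
  | .merge e₁ e₂, σ => .merge (e₁.tySubst σ) (e₂.tySubst σ)
  | .fix A e, σ => .fix (A.subst σ) (e.tySubst σ)
  | .app e₁ e₂, σ => .app (e₁.tySubst σ) (e₂.tySubst σ)
  | .tapp e A, σ => .tapp (e.tySubst σ) (A.subst σ)
  | .proj e l, σ => .proj (e.tySubst σ) l

/-- `e[X ↦ C]`, where `X` is the type variable `0` of `e`. -/
def Tm.tyInst (e : Tm) (C : Ty) : Tm := e.tySubst (instTy C)

/-- Weakening of a term by one fresh type variable (index `0`). -/
def Tm.tyShift (e : Tm) : Tm := e.tySubst (fun n => .var (n + 1))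

/-- Renaming of the term variables of a term. -/
def Tm.rename : Tm → (ℕ → ℕ) → Tm
  | .var x, ξ => .var (ξ x)
  | .lit i, _ => .lit i
  | .top, _ => .top
  | .lam A e, ξ => .lam A (e.rename (upRen ξ))
  | .tlam e, ξ => .tlam (e.rename ξ)
  | .rcd l e, ξ => .rcd l (e.rename ξ)
  | .anno e A, ξ => .anno (e.rename ξ) A
  | .merge e₁ e₂, ξ => .merge (e₁.rename ξ) (e₂.rename ξ)
  | .fix A e, ξ => .fix A (e.rename (upRen ξ))
  | .app e₁ e₂, ξ => .app (e₁.rename ξ) (e₂.rename ξ)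
  | .tapp e A, ξ => .tapp (e.rename ξ) A
  | .proj e l, ξ => .proj (e.rename ξ) l

/-- Lifting of a term substitution under a term binder. -/
def upSubst (σ : ℕ → Tm) : ℕ → Tm
  | 0 => .var 0
  | n + 1 => (σ n).rename Nat.succ

/-- Simultaneous capture-avoiding substitution of terms for term variables. -/
def Tm.subst : Tm → (ℕ → Tm) → Tm
  | .var x, σ => σ x
  | .lit i, _ => .lit i
  | .top, _ => .top
  | .lam A e, σ => .lam A (e.subst (upSubst σ))
  | .tlam e, σ => .tlam (e.subst (fun n => (σ n).tyShift))
  | .rcd l e, σ => .rcd l (e.subst σ)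
  | .anno e A, σ => .anno (e.subst σ) A
  | .merge e₁ e₂, σ => .merge (e₁.subst σ) (e₂.subst σ)
  | .fix A e, σ => .fix A (e.subst (upSubst σ))
  | .app e₁ e₂, σ => .app (e₁.subst σ) (e₂.subst σ)
  | .tapp e A, σ => .tapp (e.subst σ) A
  | .proj e l, σ => .proj (e.subst σ) l

/-- `e[x ↦ u]`, where `x` is the term variable `0` of `e`. -/
def Tm.inst (e u : Tm) : Tm :=
  e.subst (fun n => match n with
    | 0 => u
    | n + 1 => .var n)

/-- Checkable terms `p`. -/
inductive Checkable : Tm → Prop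
  | lam (A : Ty) (e : Tm) : Checkable (.lam A e)
  | tlam (e : Tm) : Checkable (.tlam e)
  | rcd (l : Label) (e : Tm) : Checkable (.rcd l e)

/-- Values `v ::= p | p : A | i | ⊤ | v₁ ,, v₂`. -/
inductive Value : Tm → Prop
  | chk {p : Tm} : Checkable p → Value p
  | anno {p : Tm} (A : Ty) : Checkable p → Value (.anno p A)
  | lit (i : ℤ) : Value (.lit i)
  | top : Value .top
  | merge {v₁ v₂ : Tm} : Value v₁ → Value v₂ → Value (.merge v₁ v₂)

/-- Pre-values `u ::= i | ⊤ | e : A | u₁ ,, u₂`. -/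
inductive PreValue : Tm → Prop
  | lit (i : ℤ) : PreValue (.lit i)
  | top : PreValue .top
  | anno (e : Tm) (A : Ty) : PreValue (.anno e A)
  | merge {u₁ u₂ : Tm} : PreValue u₁ → PreValue u₂ → PreValue (.merge u₁ u₂)

/-- Type contexts: `A :: Δ` is `Δ, X * A`, where `X` has index `0`. The entry `A` is a type over
`Δ`. -/
abbrev TCtx := List Ty

/-- Term contexts: `A :: Γ` is `Γ, x : A`, where `x` has index `0`. -/
abbrev Ctx := List Ty

/-- `TMem Δ X A`: the entry `X * A` is in `Δ`, where `A` is weakened to a type over all of `Δ`. -/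
inductive TMem : TCtx → ℕ → Ty → Prop
  | here (Δ : TCtx) (A : Ty) : TMem (A :: Δ) 0 A.shift
  | there {Δ : TCtx} {X : ℕ} {A : Ty} (B : Ty) : TMem Δ X A → TMem (B :: Δ) (X + 1) A.shift

/-- Type well-formedness `Δ ⊢ A`. -/
inductive TWf : TCtx → Ty → Prop
  | top {Δ : TCtx} : TWf Δ .top
  | bot {Δ : TCtx} : TWf Δ .bot
  | int {Δ : TCtx} : TWf Δ .int
  | var {Δ : TCtx} {X : ℕ} {A : Ty} : TMem Δ X A → TWf Δ (.var X)
  | rcd {Δ : TCtx} {l : Label} {A : Ty} : TWf Δ A → TWf Δ (.rcd l A)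
  | arrow {Δ : TCtx} {A B : Ty} : TWf Δ A → TWf Δ B → TWf Δ (.arrow A B)
  | and {Δ : TCtx} {A B : Ty} : TWf Δ A → TWf Δ B → TWf Δ (.and A B)
  | all {Δ : TCtx} {A B : Ty} : TWf Δ A → TWf (A :: Δ) B → TWf Δ (.all A B)

/-- Type context well-formedness `⊢ Δ`. -/
inductive TCWf : TCtx → Prop
  | empty : TCWf []
  | cons {Δ : TCtx} {A : Ty} : TCWf Δ → TWf Δ A → TCWf (A :: Δ)

/-- Term context well-formedness `Δ ⊢ Γ`. -/
inductive CWf : TCtx → Ctx → Prop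
  | empty {Δ : TCtx} : CWf Δ []
  | cons {Δ : TCtx} {Γ : Ctx} {A : Ty} : CWf Δ Γ → TWf Δ A → CWf Δ (A :: Γ)

/-- Declarative subtyping `Δ ⊢ A <: B`. -/
inductive Sub : TCtx → Ty → Ty → Prop
  | refl {Δ : TCtx} {A : Ty} : TCWf Δ → TWf Δ A → Sub Δ A A
  | trans {Δ : TCtx} {A B C : Ty} : Sub Δ A B → Sub Δ B C → Sub Δ A C
  | top {Δ : TCtx} {A : Ty} : TCWf Δ → TWf Δ A → Sub Δ A .top
  | bot {Δ : TCtx} {A : Ty} : TCWf Δ → TWf Δ A → Sub Δ .bot A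
  | and {Δ : TCtx} {A B C : Ty} : Sub Δ A B → Sub Δ A C → Sub Δ A (.and B C)
  | andl {Δ : TCtx} {A B : Ty} : TCWf Δ → TWf Δ A → TWf Δ B → Sub Δ (.and A B) A
  | andr {Δ : TCtx} {A B : Ty} : TCWf Δ → TWf Δ A → TWf Δ B → Sub Δ (.and A B) B
  | arrow {Δ : TCtx} {A₁ A₂ B₁ B₂ : Ty} :
      Sub Δ B₁ A₁ → Sub Δ A₂ B₂ → Sub Δ (.arrow A₁ A₂) (.arrow B₁ B₂)
  | distArrow {Δ : TCtx} {A B C : Ty} : TCWf Δ → TWf Δ A → TWf Δ B → TWf Δ C →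
      Sub Δ (.and (.arrow A B) (.arrow A C)) (.arrow A (.and B C))
  | topArrow {Δ : TCtx} : TCWf Δ → Sub Δ .top (.arrow .top .top)
  | rcd {Δ : TCtx} {l : Label} {A B : Ty} : Sub Δ A B → Sub Δ (.rcd l A) (.rcd l B)
  | distRcd {Δ : TCtx} {l : Label} {A B : Ty} : TCWf Δ → TWf Δ A → TWf Δ B →
      Sub Δ (.and (.rcd l A) (.rcd l B)) (.rcd l (.and A B))
  | topRcd {Δ : TCtx} {l : Label} : TCWf Δ → Sub Δ .top (.rcd l .top)
  | all {Δ : TCtx} {A₁ A₂ B₁ B₂ : Ty} :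
      Sub Δ B₁ A₁ → Sub (B₁ :: Δ) A₂ B₂ → Sub Δ (.all A₁ A₂) (.all B₁ B₂)
  | topAll {Δ : TCtx} : TCWf Δ → Sub Δ .top (.all .top .top)
  | distAll {Δ : TCtx} {A B C : Ty} :
      TCWf Δ → TWf Δ A → TWf (A :: Δ) B → TWf (A :: Δ) C →
      Sub Δ (.and (.all A B) (.all A C)) (.all A (.and B C))
  | topVar {Δ : TCtx} {X : ℕ} {A : Ty} :
      TCWf Δ → TMem Δ X A → Sub Δ A .bot → Sub Δ .top (.var X)

/-- Bottom-like types. -/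
inductive BotLike : Ty → Prop
  | bot : BotLike .bot
  | andl {A B : Ty} : BotLike A → BotLike (.and A B)
  | andr {A B : Ty} : BotLike B → BotLike (.and A B)

/-- Top-like types under a type context. -/
inductive TopLike : TCtx → Ty → Prop
  | top {Δ : TCtx} : TCWf Δ → TopLike Δ .top
  | and {Δ : TCtx} {A B : Ty} : TopLike Δ A → TopLike Δ B → TopLike Δ (.and A B)
  | arrow {Δ : TCtx} {A B : Ty} : TWf Δ A → TopLike Δ B → TopLike Δ (.arrow A B)
  | rcd {Δ : TCtx} {l : Label} {A : Ty} : TopLike Δ A → TopLike Δ (.rcd l A)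
  | all {Δ : TCtx} {A B : Ty} : TopLike (A :: Δ) B → TopLike Δ (.all A B)
  | var {Δ : TCtx} {X : ℕ} {A : Ty} : TCWf Δ → TMem Δ X A → BotLike A → TopLike Δ (.var X)

/-- Ordinary types. -/
inductive Ordinary : Ty → Prop
  | var (X : ℕ) : Ordinary (.var X)
  | int : Ordinary .int
  | top : Ordinary .top
  | bot : Ordinary .bot
  | arrow (A : Ty) {B : Ty} : Ordinary B → Ordinary (.arrow A B)
  | all (A : Ty) {B : Ty} : Ordinary B → Ordinary (.all A B)
  | rcd (l : Label) {A : Ty} : Ordinary A → Ordinary (.rcd l A)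

/-- Type splitting: `Split B A C` is `B ◁ A ▷ C`. -/
inductive Split : Ty → Ty → Ty → Prop
  | arrow (A : Ty) {B B₁ B₂ : Ty} :
      Split B₁ B B₂ → Split (.arrow A B₁) (.arrow A B) (.arrow A B₂)
  | rcd (l : Label) {A A₁ A₂ : Ty} : Split A₁ A A₂ → Split (.rcd l A₁) (.rcd l A) (.rcd l A₂)
  | all (A : Ty) {B B₁ B₂ : Ty} : Split B₁ B B₂ → Split (.all A B₁) (.all A B) (.all A B₂)
  | and (A B : Ty) : Split A (.and A B) B

/-- Type disjointness axioms. -/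
inductive DisjointAx : Ty → Ty → Prop
  | symm {A B : Ty} : DisjointAx A B → DisjointAx B A
  | intArrow (A B : Ty) : DisjointAx .int (.arrow A B)
  | intRcd (l : Label) (A : Ty) : DisjointAx .int (.rcd l A)
  | intAll (A B : Ty) : DisjointAx .int (.all A B)
  | arrowRcd (A B : Ty) (l : Label) (C : Ty) : DisjointAx (.arrow A B) (.rcd l C)
  | arrowAll (A B C D : Ty) : DisjointAx (.arrow A B) (.all C D)
  | rcdAll (l : Label) (A B C : Ty) : DisjointAx (.rcd l A) (.all B C)

/-- Type disjointness `Δ ⊢ A * B`. -/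
inductive TDisjoint : TCtx → Ty → Ty → Prop
  | ax {Δ : TCtx} {A B : Ty} : TCWf Δ → TWf Δ A → TWf Δ B → DisjointAx A B → TDisjoint Δ A B
  | topl {Δ : TCtx} {A B : Ty} : TopLike Δ A → TWf Δ B → TDisjoint Δ A B
  | topr {Δ : TCtx} {A B : Ty} : TWf Δ A → TopLike Δ B → TDisjoint Δ A B
  | andl {Δ : TCtx} {A A₁ A₂ B : Ty} :
      Split A₁ A A₂ → TDisjoint Δ A₁ B → TDisjoint Δ A₂ B → TDisjoint Δ A B
  | andr {Δ : TCtx} {A B B₁ B₂ : Ty} :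
      Split B₁ B B₂ → TDisjoint Δ A B₁ → TDisjoint Δ A B₂ → TDisjoint Δ A B
  | varl {Δ : TCtx} {X : ℕ} {A B : Ty} : TMem Δ X A → Sub Δ A B → TDisjoint Δ (.var X) B
  | varr {Δ : TCtx} {X : ℕ} {A B : Ty} : TMem Δ X A → Sub Δ A B → TDisjoint Δ B (.var X)
  | arrow {Δ : TCtx} {A₁ A₂ B₁ B₂ : Ty} : TWf Δ A₁ → TWf Δ B₁ → TDisjoint Δ A₂ B₂ →
      TDisjoint Δ (.arrow A₁ A₂) (.arrow B₁ B₂)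
  | rcdEq {Δ : TCtx} {l : Label} {A B : Ty} :
      TDisjoint Δ A B → TDisjoint Δ (.rcd l A) (.rcd l B)
  | rcdNeq {Δ : TCtx} {l₁ l₂ : Label} {A B : Ty} :
      TCWf Δ → TWf Δ A → TWf Δ B → l₁ ≠ l₂ → TDisjoint Δ (.rcd l₁ A) (.rcd l₂ B)
  | all {Δ : TCtx} {A₁ A₂ B₁ B₂ : Ty} : TWf Δ A₁ → TWf Δ B₁ →
      TDisjoint (.and A₁ B₁ :: Δ) A₂ B₂ → TDisjoint Δ (.all A₁ A₂) (.all B₁ B₂)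

/-- Principal types of pre-values: `PType u A` is `u : A`. -/
inductive PType : Tm → Ty → Prop
  | top : PType .top .top
  | lit (i : ℤ) : PType (.lit i) .int
  | anno (e : Tm) (A : Ty) : PType (.anno e A) A
  | merge {u₁ u₂ : Tm} {A B : Ty} :
      PType u₁ A → PType u₂ B → PType (.merge u₁ u₂) (.and A B)

/-- Consistency of pre-values `u₁ ≈ u₂`. -/
inductive Consistent : Tm → Tm → Prop
  | lit (i : ℤ) : Consistent (.lit i) (.lit i)
  | anno (e : Tm) (A B : Ty) : Consistent (.anno e A) (.anno e B)
  | disjoint {u₁ u₂ : Tm} {A B : Ty} :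
      PType u₁ A → PType u₂ B → TDisjoint [] A B → Consistent u₁ u₂
  | mergel {u₁ u₂ u : Tm} : Consistent u₁ u → Consistent u₂ u → Consistent (.merge u₁ u₂) u
  | merger {u u₁ u₂ : Tm} : Consistent u u₁ → Consistent u u₂ → Consistent u (.merge u₁ u₂)

/-- Applicative distribution: `AppDist A B` is `A ▷ B`. -/
inductive AppDist : Ty → Ty → Prop
  | andArrow {A B A₁ A₂ B₁ B₂ : Ty} : AppDist A (.arrow A₁ A₂) → AppDist B (.arrow B₁ B₂) →
      AppDist (.and A B) (.arrow (.and A₁ B₁) (.and A₂ B₂))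
  | andRcd {l : Label} {A B A₁ B₁ : Ty} : AppDist A (.rcd l A₁) → AppDist B (.rcd l B₁) →
      AppDist (.and A B) (.rcd l (.and A₁ B₁))
  | andAll {A B A₁ A₂ B₁ B₂ : Ty} : AppDist A (.all A₁ A₂) → AppDist B (.all B₁ B₂) →
      AppDist (.and A B) (.all (.and A₁ B₁) (.and A₂ B₂))
  | refl (A : Ty) : AppDist A A

/-- Typing modes: synthesis `⇒` and checking `⇐`. -/
inductive Mode : Type
  | inf
  | chk

/-- Bidirectional typing: `Typing Δ Γ e .inf A` is `Δ; Γ ⊢ e ⇒ A` and `Typing Δ Γ e .chk A` is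
`Δ; Γ ⊢ e ⇐ A`. -/
inductive Typing : TCtx → Ctx → Tm → Mode → Ty → Prop
  | top {Δ : TCtx} {Γ : Ctx} : TCWf Δ → CWf Δ Γ → Typing Δ Γ .top .inf .top
  | lit {Δ : TCtx} {Γ : Ctx} (i : ℤ) : TCWf Δ → CWf Δ Γ → Typing Δ Γ (.lit i) .inf .int
  | var {Δ : TCtx} {Γ : Ctx} {x : ℕ} {A : Ty} :
      TCWf Δ → CWf Δ Γ → Γ[x]? = some A → Typing Δ Γ (.var x) .inf A
  | abs {Δ : TCtx} {Γ : Ctx} {A B₁ B₂ : Ty} {e : Tm} :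
      Sub Δ B₁ A → Typing Δ (A :: Γ) e .chk B₂ → Typing Δ Γ (.lam A e) .chk (.arrow B₁ B₂)
  | tabs {Δ : TCtx} {Γ : Ctx} {A B : Ty} {e : Tm} :
      Typing (A :: Δ) (Γ.map Ty.shift) e .chk B → Typing Δ Γ (.tlam e) .chk (.all A B)
  | rcd {Δ : TCtx} {Γ : Ctx} {l : Label} {A : Ty} {e : Tm} :
      Typing Δ Γ e .chk A → Typing Δ Γ (.rcd l e) .chk (.rcd l A)
  | app {Δ : TCtx} {Γ : Ctx} {A B C : Ty} {e₁ e₂ : Tm} :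
      Typing Δ Γ e₁ .inf A → AppDist A (.arrow B C) → Typing Δ Γ e₂ .chk B →
      Typing Δ Γ (.app e₁ e₂) .inf C
  | tapp {Δ : TCtx} {Γ : Ctx} {A B C D : Ty} {e : Tm} :
      Typing Δ Γ e .inf A → AppDist A (.all B C) → TDisjoint Δ D B →
      Typing Δ Γ (.tapp e D) .inf (C.inst D)
  | proj {Δ : TCtx} {Γ : Ctx} {l : Label} {A B : Ty} {e : Tm} :
      Typing Δ Γ e .inf A → AppDist A (.rcd l B) → Typing Δ Γ (.proj e l) .inf B
  | merge {Δ : TCtx} {Γ : Ctx} {A B : Ty} {e₁ e₂ : Tm} :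
      Typing Δ Γ e₁ .inf A → Typing Δ Γ e₂ .inf B → TDisjoint Δ A B →
      Typing Δ Γ (.merge e₁ e₂) .inf (.and A B)
  | mergev {Δ : TCtx} {Γ : Ctx} {A B : Ty} {u₁ u₂ : Tm} :
      TCWf Δ → CWf Δ Γ → PreValue u₁ → PreValue u₂ →
      Typing [] [] u₁ .inf A → Typing [] [] u₂ .inf B → Consistent u₁ u₂ →
      Typing Δ Γ (.merge u₁ u₂) .inf (.and A B)
  | inter {Δ : TCtx} {Γ : Ctx} {A B : Ty} {e : Tm} :
      Typing Δ Γ e .chk A → Typing Δ Γ e .chk B → Typing Δ Γ e .chk (.and A B)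
  | fix {Δ : TCtx} {Γ : Ctx} {A : Ty} {e : Tm} :
      Typing Δ (A :: Γ) e .chk A → Typing Δ Γ (.fix A e) .inf A
  | anno {Δ : TCtx} {Γ : Ctx} {A : Ty} {e : Tm} :
      Typing Δ Γ e .chk A → Typing Δ Γ (.anno e A) .inf A
  | sub {Δ : TCtx} {Γ : Ctx} {A B : Ty} {e : Tm} :
      Typing Δ Γ e .inf A → Sub Δ A B → Typing Δ Γ e .chk B

/-- The top-like value generator, a partial function. It is defined on all closed ordinary
top-like types. -/
def topGen : Ty → Option Tm
  | .top => some .top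
  | .arrow A B => some (.anno (.lam .top .top) (.arrow A B))
  | .rcd l A => some (.anno (.rcd l .top) (.rcd l A))
  | .all A B => some (.anno (.tlam .top) (.all A B))
  | _ => none

/-- Expression wrapping: `Wrap e A u` is `e ⇝_A u`. -/
inductive Wrap : Tm → Ty → Tm → Prop
  | top {e v : Tm} {A : Ty} : Ordinary A → TopLike [] A → topGen A = some v → Wrap e A v
  | anno {e : Tm} {A : Ty} : Ordinary A → ¬ TopLike [] A → Wrap e A (.anno e A)
  | and {e u₁ u₂ : Tm} {A B C : Ty} :
      Split B A C → Wrap e B u₁ → Wrap e C u₂ → Wrap e A (.merge u₁ u₂)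

/-- Casting of values: `Cast v A v'` is `v ↪_A v'`. -/
inductive Cast : Tm → Ty → Tm → Prop
  | int (i : ℤ) : Cast (.lit i) .int (.lit i)
  | top {v v' : Tm} {A : Ty} :
      Value v → Ordinary A → TopLike [] A → topGen A = some v' → Cast v A v'
  | mergel {v₁ v₂ v₁' : Tm} {A : Ty} :
      Value v₂ → Ordinary A → Cast v₁ A v₁' → Cast (.merge v₁ v₂) A v₁'
  | merger {v₁ v₂ v₂' : Tm} {A : Ty} :
      Value v₁ → Ordinary A → Cast v₂ A v₂' → Cast (.merge v₁ v₂) A v₂'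
  | anno {p : Tm} {A B : Ty} : Checkable p → Ordinary B → ¬ TopLike [] B → Sub [] A B →
      Cast (.anno p A) B (.anno p B)
  | and {v v₁ v₂ : Tm} {A B C : Ty} :
      Split B A C → Cast v B v₁ → Cast v C v₂ → Cast v A (.merge v₁ v₂)

/-- Arguments of parallel application: expressions, types and labels. -/
inductive Arg : Type
  | tm (e : Tm)
  | ty (A : Ty)
  | label (l : Label)

/-- Parallel application: `PApp v arg u` is `v • arg ↪ u`. -/
inductive PApp : Tm → Arg → Tm → Prop
  | abs {A B C D : Ty} {e e' u : Tm} : AppDist B (.arrow C D) → Wrap e' A u →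
      PApp (.anno (.lam A e) B) (.tm e') (.anno (e.inst u) D)
  | tabs {A B C D : Ty} {e : Tm} : AppDist A (.all B C) →
      PApp (.anno (.tlam e) A) (.ty D) (.anno (e.tyInst D) (C.inst D))
  | proj {l : Label} {A B : Ty} {e : Tm} : AppDist A (.rcd l B) →
      PApp (.anno (.rcd l e) A) (.label l) (.anno e B)
  | merge {v₁ v₂ u₁ u₂ : Tm} {a : Arg} : Value v₁ → Value v₂ → PApp v₁ a u₁ → PApp v₂ a u₂ →
      PApp (.merge v₁ v₂) a (.merge u₁ u₂)

/-- Small-step call-by-name reduction `e ↪ e'`. The constructors `cntx…` are the instances of the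
reduction rule for the evaluation contexts `[] e`, `[] A`, `[].l`, `[] ,, v`, `v ,, []`, `[] : A`. -/
inductive Step : Tm → Tm → Prop
  | papp {v e e' : Tm} : Value v → PApp v (.tm e) e' → Step (.app v e) e'
  | pproj {v e' : Tm} {l : Label} : Value v → PApp v (.label l) e' → Step (.proj v l) e'
  | ptapp {v e' : Tm} {A : Ty} : Value v → PApp v (.ty A) e' → Step (.tapp v A) e'
  | fix {A : Ty} {e : Tm} : Step (.fix A e) (.anno (e.inst (.fix A e)) A)
  | annov {v v' : Tm} {A : Ty} : Value v → PreValue v → Cast v A v' → Step (.anno v A) v'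
  | merge {e₁ e₂ e₁' e₂' : Tm} :
      Step e₁ e₁' → Step e₂ e₂' → Step (.merge e₁ e₂) (.merge e₁' e₂')
  | cntxApp {e₁ e₁' e₂ : Tm} : Step e₁ e₁' → Step (.app e₁ e₂) (.app e₁' e₂)
  | cntxTapp {e e' : Tm} {A : Ty} : Step e e' → Step (.tapp e A) (.tapp e' A)
  | cntxProj {e e' : Tm} {l : Label} : Step e e' → Step (.proj e l) (.proj e' l)
  | cntxMergel {e e' v : Tm} : Value v → Step e e' → Step (.merge e v) (.merge e' v)
  | cntxMerger {e e' v : Tm} : Value v → Step e e' → Step (.merge v e) (.merge v e')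
  | cntxAnno {e e' : Tm} {A : Ty} : Step e e' → Step (.anno e A) (.anno e' A)

end FiPlus

namespace FiPlus

/-! ### Splitting and ordinary types -/

/-! Values do not reduce, so a context rule never competes with a redex. Splitting, wrapping,
applicative distribution towards a fixed type constructor, and hence parallel application, are
syntax-directed. The only real choice lies in casting a merge at an ordinary type, where either
component may be used.

Typing makes the components of a merge of pre-values consistent, and `Consistent.cast_eq` shows that
consistent pre-values have equal casts. Its substantial case is disjointness. Unless the target is
already known to be top-like, it is an ordinary common supertype of two disjoint types; by
`TDisjoint.topIn` such a type is top-like after all, and a cast at an ordinary top-like type always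
returns the output of `topGen`, whatever the value was.

Reasoning about common supertypes requires inverting subtyping, which the transitivity rule
obstructs. `ASub` is therefore a transitivity-free version that decomposes the right-hand type by
splitting. Subtyping consults the context only to learn which variables have a bottom-like bound,
and these are the top-like variables; so `ASub` carries just that set, and narrowing a bound becomes
monotonicity in the set. `ASub.trans` is the admissibility of transitivity, and `Sub.aSub` transfers
declarative derivations. -/

theorem Split.unique {A B C B' C' : Ty} (h : Split B A C) (h' : Split B' A C') :
    B = B' ∧ C = C' := by
  induction h generalizing B' C' with
  | and => cases h'; exact ⟨rfl, rfl⟩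
  | arrow _ _ ih | rcd _ _ ih | all _ _ ih =>
    cases h' with | _ _ h' => obtain ⟨rfl, rfl⟩ := ih h'; exact ⟨rfl, rfl⟩

theorem Ordinary.not_split {A B C : Ty} (h : Ordinary A) (h' : Split B A C) : False := by
  induction h' with
  | and => cases h
  | arrow _ _ ih | rcd _ _ ih | all _ _ ih => cases h; exact ih ‹_›

theorem ordinary_or_split (A : Ty) : Ordinary A ∨ ∃ B C, Split B A C := by
  induction A with
  | var X => exact .inl (.var X)
  | int => exact .inl .int
  | top => exact .inl .top
  | bot => exact .inl .bot
  | and A B => exact .inr ⟨_, _, .and A B⟩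
  | arrow A B _ ih =>
    obtain h | ⟨_, _, h⟩ := ih
    exacts [.inl (.arrow A h), .inr ⟨_, _, .arrow A h⟩]
  | all A B _ ih =>
    obtain h | ⟨_, _, h⟩ := ih
    exacts [.inl (.all A h), .inr ⟨_, _, .all A h⟩]
  | rcd l A ih =>
    obtain h | ⟨_, _, h⟩ := ih
    exacts [.inl (.rcd l h), .inr ⟨_, _, .rcd l h⟩]

/-- Number of constructors of a type. -/
def Ty.size : Ty → ℕ
  | .var _ | .int | .top | .bot => 1
  | .and A B | .arrow A B | .all A B => A.size + B.size + 1
  | .rcd _ A => A.size + 1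

theorem Split.size_lt {A B C : Ty} (h : Split B A C) : B.size < A.size ∧ C.size < A.size := by
  induction h <;> simp only [Ty.size] <;> omega

/-! ### Top-likeness relative to a set of top-like type variables -/

/-- Extension of a predicate on variables under a binder. -/
def extVar (P : Prop) (T : ℕ → Prop) : ℕ → Prop
  | 0 => P
  | n + 1 => T n

theorem extVar_mono {P Q : Prop} {T T' : ℕ → Prop} (h : P → Q) (hT : ∀ X, T X → T' X) :
    ∀ X, extVar P T X → extVar Q T' X
  | 0 => h
  | n + 1 => hT n

/-- Top-likeness of a type when the variables in `T` are top-like. -/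
def TopIn : (ℕ → Prop) → Ty → Prop
  | T, .var X => T X
  | _, .int => False
  | _, .top => True
  | _, .bot => False
  | T, .and A B => TopIn T A ∧ TopIn T B
  | T, .arrow _ B => TopIn T B
  | T, .all A B => TopIn (extVar (BotLike A) T) B
  | T, .rcd _ A => TopIn T A

theorem TopIn.mono {A : Ty} {T T' : ℕ → Prop} (hT : ∀ X, T X → T' X) (h : TopIn T A) :
    TopIn T' A := by
  induction A generalizing T T' with
  | var X => exact hT _ h
  | int | bot => exact h
  | top => trivial
  | and A B ihA ihB => exact ⟨ihA hT h.1, ihB hT h.2⟩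
  | arrow A B _ ih => exact ih (T := T) hT h
  | all A B _ ih => exact ih (extVar_mono id hT) h
  | rcd l A ih => exact ih (T := T) hT h

theorem Split.topIn_iff {A B C : Ty} {T : ℕ → Prop} (h : Split B A C) :
    TopIn T A ↔ TopIn T B ∧ TopIn T C := by
  induction h generalizing T with
  | and => exact Iff.rfl
  | arrow _ _ ih | rcd _ _ ih | all _ _ ih => exact ih

theorem BotLike.not_topIn {A : Ty} {T : ℕ → Prop} (h : BotLike A) (h' : TopIn T A) : False := by
  induction h with
  | bot => exact h'
  | andl _ ih => exact ih h'.1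
  | andr _ ih => exact ih h'.2

theorem Split.botLike {A B C : Ty} (h : Split B A C) (hA : BotLike A) :
    BotLike B ∨ BotLike C := by
  cases h <;> cases hA
  exacts [.inl ‹_›, .inr ‹_›]

/-! ### Algorithmic subtyping -/

/-- Subtyping without transitivity, relative to a set of top-like type variables. -/
inductive ASub : (ℕ → Prop) → Ty → Ty → Prop
  | top {T : ℕ → Prop} {A B : Ty} : TopIn T B → ASub T A B
  | bot {T : ℕ → Prop} {B : Ty} : ASub T .bot B
  | int {T : ℕ → Prop} : ASub T .int .int
  | var {T : ℕ → Prop} {X : ℕ} : ASub T (.var X) (.var X)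
  | andl {T : ℕ → Prop} {A B C : Ty} : ASub T A C → ASub T (.and A B) C
  | andr {T : ℕ → Prop} {A B C : Ty} : ASub T B C → ASub T (.and A B) C
  | arrow {T : ℕ → Prop} {A₁ A₂ B₁ B₂ : Ty} :
      ASub T B₁ A₁ → ASub T A₂ B₂ → ASub T (.arrow A₁ A₂) (.arrow B₁ B₂)
  | rcd {T : ℕ → Prop} {l : Label} {A B : Ty} : ASub T A B → ASub T (.rcd l A) (.rcd l B)
  | all {T : ℕ → Prop} {A₁ A₂ B₁ B₂ : Ty} :
      ASub T B₁ A₁ → ASub (extVar (BotLike B₁) T) A₂ B₂ → ASub T (.all A₁ A₂) (.all B₁ B₂)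
  | split {T : ℕ → Prop} {A B B₁ B₂ : Ty} :
      Split B₁ B B₂ → ASub T A B₁ → ASub T A B₂ → ASub T A B

theorem ASub.refl (T : ℕ → Prop) (A : Ty) : ASub T A A := by
  induction A generalizing T with
  | var X => exact .var
  | int => exact .int
  | top => exact .top trivial
  | bot => exact .bot
  | and A B ihA ihB => exact .split (.and A B) (.andl (ihA T)) (.andr (ihB T))
  | arrow A B ihA ihB => exact .arrow (ihA T) (ihB T)
  | all A B ihA ihB => exact .all (ihA T) (ihB _)
  | rcd l A ih => exact .rcd (ih T)

theorem ASub.mono {T T' : ℕ → Prop} {A B : Ty} (h : ASub T A B) (hT : ∀ X, T X → T' X) :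
    ASub T' A B := by
  induction h generalizing T' with
  | top h => exact .top (h.mono hT)
  | bot => exact .bot
  | int => exact .int
  | var => exact .var
  | andl _ ih => exact .andl (ih hT)
  | andr _ ih => exact .andr (ih hT)
  | arrow _ _ ih₁ ih₂ => exact .arrow (ih₁ hT) (ih₂ hT)
  | rcd _ ih => exact .rcd (ih hT)
  | all _ _ ih₁ ih₂ => exact .all (ih₁ hT) (ih₂ (extVar_mono id hT))
  | split hs _ _ ih₁ ih₂ => exact .split hs (ih₁ hT) (ih₂ hT)

/-- No bottom-like type is top-like, so the `top` rule cannot interfere. The lemma serves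
contravariant bounds: lowering the bound of a variable can only turn the variable top-like, never
the reverse. -/
theorem ASub.botLike {T : ℕ → Prop} {A B : Ty} (h : ASub T A B) (hB : BotLike B) :
    BotLike A := by
  induction h with
  | top h => exact (hB.not_topIn h).elim
  | bot => exact .bot
  | int | var | arrow | rcd | all => cases hB
  | andl _ ih => exact .andl (ih hB)
  | andr _ ih => exact .andr (ih hB)
  | split hs _ _ ih₁ ih₂ => exact (hs.botLike hB).elim ih₁ ih₂

theorem BotLike.aSub {T : ℕ → Prop} {A B : Ty} (h : BotLike A) : ASub T A B := by
  induction h with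
  | bot => exact .bot
  | andl _ ih => exact .andl ih
  | andr _ ih => exact .andr ih

theorem ASub.topIn {T : ℕ → Prop} {A B : Ty} (h : ASub T A B) (hA : TopIn T A) : TopIn T B := by
  induction h with
  | top h => exact h
  | bot => exact hA.elim
  | int | var => exact hA
  | andl _ ih => exact ih hA.1
  | andr _ ih => exact ih hA.2
  | arrow _ _ _ ih => exact ih hA
  | rcd _ ih => exact ih hA
  -- The bound on the right is smaller, so the set of top-like variables under the binder can only
  -- grow.
  | all h _ _ ih => exact ih (TopIn.mono (extVar_mono h.botLike fun _ => id) hA)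
  | split hs _ _ ih₁ ih₂ => exact hs.topIn_iff.2 ⟨ih₁ hA, ih₂ hA⟩

theorem ASub.split_right {T : ℕ → Prop} {A B B₁ B₂ : Ty} (h : ASub T A B)
    (hs : Split B₁ B B₂) : ASub T A B₁ ∧ ASub T A B₂ := by
  induction h generalizing B₁ B₂ with
  | top h => exact ⟨.top (hs.topIn_iff.1 h).1, .top (hs.topIn_iff.1 h).2⟩
  | bot => exact ⟨.bot, .bot⟩
  | int | var => cases hs
  | andl _ ih => exact ⟨.andl (ih hs).1, .andl (ih hs).2⟩
  | andr _ ih => exact ⟨.andr (ih hs).1, .andr (ih hs).2⟩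
  | arrow h _ _ ih =>
    cases hs with | arrow _ hs => exact ⟨.arrow h (ih hs).1, .arrow h (ih hs).2⟩
  | rcd _ ih => cases hs with | rcd _ hs => exact ⟨.rcd (ih hs).1, .rcd (ih hs).2⟩
  | all h _ _ ih => cases hs with | all _ hs => exact ⟨.all h (ih hs).1, .all h (ih hs).2⟩
  | split hs' h₁ h₂ =>
    obtain ⟨rfl, rfl⟩ := hs.unique hs'
    exact ⟨h₁, h₂⟩

/-- Ordinary types are prime for splitting: with an ordinary target the `split` rule is unavailable,
so a derivation commits to one half of the source. -/
theorem ASub.split_left {T : ℕ → Prop} {A A₁ A₂ B : Ty} (h : ASub T A B) (hB : Ordinary B)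
    (hs : Split A₁ A A₂) : ASub T A₁ B ∨ ASub T A₂ B := by
  induction h generalizing A₁ A₂ with
  | top h => exact .inl (.top h)
  | bot | int | var => cases hs
  | andl h => cases hs; exact .inl h
  | andr h => cases hs; exact .inr h
  | arrow h _ _ ih =>
    cases hs with | arrow _ hs =>
    cases hB with | arrow _ hB => exact (ih hB hs).imp (.arrow h) (.arrow h)
  | rcd _ ih =>
    cases hs with | rcd _ hs =>
    cases hB with | rcd _ hB => exact (ih hB hs).imp .rcd .rcd
  | all h _ _ ih =>
    cases hs with | all _ hs =>
    cases hB with | all _ hB => exact (ih hB hs).imp (.all h) (.all h)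
  | split hs' => exact (hB.not_split hs').elim

/-- Induction on the total size of the three types, a measure unaffected by the exchange of outer
types in contravariant positions. Splitting `C`, then `B`, reduces to the case where both are
ordinary; there the two derivations match constructor by constructor. -/
theorem ASub.trans {T : ℕ → Prop} {A B C : Ty} (h₁ : ASub T A B) (h₂ : ASub T B C) :
    ASub T A C := by
  obtain hC | ⟨C₁, C₂, hC⟩ := ordinary_or_split C
  swap
  · have := hC.size_lt
    obtain ⟨h, h'⟩ := h₂.split_right hC
    exact .split hC (h₁.trans h) (h₁.trans h')
  obtain hB | ⟨B₁, B₂, hB⟩ := ordinary_or_split B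
  swap
  · have := hB.size_lt
    -- `A` lies below both halves of `B`, and one of these halves already lies below the ordinary
    -- type `C`.
    obtain ⟨h, h'⟩ := h₁.split_right hB
    obtain h'' | h'' := h₂.split_left hC hB
    exacts [h.trans h'', h'.trans h'']
  cases h₁ with
  | top h => exact .top (h₂.topIn h)
  | bot => exact .bot
  | int | var => exact h₂
  | andl h => exact .andl (h.trans h₂)
  | andr h => exact .andr (h.trans h₂)
  | split h => exact (hB.not_split h).elim
  | arrow h h' =>
    cases h₂ with
    | top h₂ => exact .top h₂
    | split h₂ => exact (hC.not_split h₂).elim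
    | arrow k k' => exact .arrow (k.trans h) (h'.trans k')
  | rcd h =>
    cases h₂ with
    | top h₂ => exact .top h₂
    | split h₂ => exact (hC.not_split h₂).elim
    | rcd k => exact .rcd (h.trans k)
  | all h h' =>
    cases h₂ with
    | top h₂ => exact .top h₂
    | split h₂ => exact (hC.not_split h₂).elim
    | all k k' =>
      -- The left body derivation lives under the larger bound of the middle type; monotonicity
      -- moves it under the bound of `C`.
      exact .all (k.trans h) ((h'.mono (extVar_mono k.botLike fun _ => id)).trans k')
termination_by A.size + B.size + C.size
decreasing_by all_goals simp_all only [Ty.size]; omega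

/-- `var X` is one of the conjuncts of a type. -/
def HasConjVar (X : ℕ) : Ty → Prop
  | .var Y => Y = X
  | .and A B => HasConjVar X A ∨ HasConjVar X B
  | _ => False

theorem ASub.var_right {T : ℕ → Prop} {A : Ty} {X : ℕ} (h : ASub T A (.var X)) :
    BotLike A ∨ HasConjVar X A ∨ T X := by
  induction A with
  | and A B ihA ihB =>
    cases h with
    | top h => exact .inr (.inr h)
    | split h => cases h
    | andl h => exact (ihA h).imp .andl (.imp_left .inl)
    | andr h => exact (ihB h).imp .andr (.imp_left .inr)
  | bot => exact .inl .bot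
  | var Y =>
    cases h with
    | top h => exact .inr (.inr h)
    | split h => cases h
    | var => exact .inr (.inl rfl)
  | _ =>
    cases h with
    | top h => exact .inr (.inr h)
    | split h => cases h

/-! ### Type contexts -/

theorem hasConjVar_shift {X : ℕ} {A : Ty} (h : HasConjVar X A.shift) :
    ∃ n, X = n + 1 ∧ HasConjVar n A := by
  induction A with
  | var Y => exact ⟨Y, h.symm, rfl⟩
  | and A B ihA ihB =>
    obtain h | h := h
    · obtain ⟨n, hn, h⟩ := ihA h
      exact ⟨n, hn, .inl h⟩
    · obtain ⟨n, hn, h⟩ := ihB h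
      exact ⟨n, hn, .inr h⟩
  | _ => exact h.elim

/-- A bound is a type over the earlier part of the context, so after weakening all its variables
have larger indices than the variable it bounds. -/
theorem TMem.not_hasConjVar {Δ : TCtx} {X : ℕ} {A : Ty} (h : TMem Δ X A) :
    ¬ HasConjVar X A := by
  induction h with
  | here Δ A =>
    intro h
    obtain ⟨n, hn, -⟩ := hasConjVar_shift h
    omega
  | there B _ ih =>
    intro h
    obtain ⟨n, hn, h⟩ := hasConjVar_shift h
    cases hn
    exact ih h

theorem botLike_shift {A : Ty} : BotLike A.shift ↔ BotLike A := by
  constructor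
  · intro h
    induction A with
    | and A B ihA ihB =>
      cases h with
      | andl h => exact .andl (ihA h)
      | andr h => exact .andr (ihB h)
    | bot => exact .bot
    | _ => cases h
  · intro h
    induction h with
    | bot => exact .bot
    | andl _ ih => exact .andl ih
    | andr _ ih => exact .andr ih

/-- The type variables with a bottom-like bound. -/
def botVars (Δ : TCtx) (X : ℕ) : Prop := ∃ A, TMem Δ X A ∧ BotLike A

theorem botVars_cons (A : Ty) (Δ : TCtx) :
    botVars (A :: Δ) = extVar (BotLike A) (botVars Δ) := by
  funext X
  apply propext
  cases X with
  | zero =>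
    constructor
    · rintro ⟨_, ⟨⟩, h⟩
      exact botLike_shift.1 h
    · exact fun h => ⟨_, .here Δ A, botLike_shift.2 h⟩
  | succ X =>
    constructor
    · rintro ⟨_, ⟨⟩, h⟩
      exact ⟨_, ‹_›, botLike_shift.1 h⟩
    · rintro ⟨_, h, h'⟩
      exact ⟨_, .there A h, botLike_shift.2 h'⟩

theorem TopLike.topIn {Δ : TCtx} {A : Ty} (h : TopLike Δ A) : TopIn (botVars Δ) A := by
  induction h with
  | top => trivial
  | and _ _ ih₁ ih₂ => exact ⟨ih₁, ih₂⟩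
  | arrow _ _ ih => exact ih
  | rcd _ ih => exact ih
  | all _ ih => rw [botVars_cons] at ih; exact ih
  | var _ h h' => exact ⟨_, h, h'⟩

theorem TopIn.topLike {Δ : TCtx} {A : Ty} (hΔ : TCWf Δ) (hA : TWf Δ A)
    (h : TopIn (botVars Δ) A) : TopLike Δ A := by
  induction hA with
  | top => exact .top hΔ
  | bot | int => exact h.elim
  | var =>
    obtain ⟨_, h, h'⟩ := h
    exact .var hΔ h h'
  | rcd _ ih => exact .rcd (ih hΔ h)
  | arrow h₁ _ _ ih => exact .arrow h₁ (ih hΔ h)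
  | and _ _ ih₁ ih₂ => exact .and (ih₁ hΔ h.1) (ih₂ hΔ h.2)
  | all h₁ _ _ ih => exact .all (ih (.cons hΔ h₁) (by rw [botVars_cons]; exact h))

theorem TMem.of_length_eq {Δ Δ' : TCtx} {X : ℕ} {A : Ty} (h : TMem Δ X A)
    (hl : Δ.length = Δ'.length) : ∃ A', TMem Δ' X A' := by
  induction h generalizing Δ' with
  | here Δ A =>
    cases Δ' with
    | nil => cases hl
    | cons B Δ' => exact ⟨_, .here Δ' B⟩
  | there B _ ih =>
    cases Δ' with
    | nil => cases hl
    | cons B Δ' =>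
      obtain ⟨_, h⟩ := ih (Nat.succ.inj hl)
      exact ⟨_, .there B h⟩

/-- Well-formedness only asks that indices be in scope. `Sub.wf` uses this to exchange the bound
above the body of a universal type. -/
theorem TWf.of_length_eq {Δ Δ' : TCtx} {A : Ty} (h : TWf Δ A)
    (hl : Δ.length = Δ'.length) : TWf Δ' A := by
  induction h generalizing Δ' with
  | top => exact .top
  | bot => exact .bot
  | int => exact .int
  | var h =>
    obtain ⟨_, h⟩ := h.of_length_eq hl
    exact .var h
  | rcd _ ih => exact .rcd (ih hl)
  | arrow _ _ ih₁ ih₂ => exact .arrow (ih₁ hl) (ih₂ hl)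
  | and _ _ ih₁ ih₂ => exact .and (ih₁ hl) (ih₂ hl)
  | all _ _ ih₁ ih₂ => exact .all (ih₁ hl) (ih₂ (congrArg Nat.succ hl))

theorem Sub.wf {Δ : TCtx} {A B : Ty} (h : Sub Δ A B) : TWf Δ A ∧ TWf Δ B := by
  induction h with
  | refl _ h => exact ⟨h, h⟩
  | trans _ _ ih₁ ih₂ => exact ⟨ih₁.1, ih₂.2⟩
  | top _ h => exact ⟨h, .top⟩
  | bot _ h => exact ⟨.bot, h⟩
  | and _ _ ih₁ ih₂ => exact ⟨ih₁.1, .and ih₁.2 ih₂.2⟩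
  | andl _ h₁ h₂ => exact ⟨.and h₁ h₂, h₁⟩
  | andr _ h₁ h₂ => exact ⟨.and h₁ h₂, h₂⟩
  | arrow _ _ ih₁ ih₂ => exact ⟨.arrow ih₁.2 ih₂.1, .arrow ih₁.1 ih₂.2⟩
  | distArrow _ h₁ h₂ h₃ => exact ⟨.and (.arrow h₁ h₂) (.arrow h₁ h₃), .arrow h₁ (.and h₂ h₃)⟩
  | topArrow => exact ⟨.top, .arrow .top .top⟩
  | rcd _ ih => exact ⟨.rcd ih.1, .rcd ih.2⟩
  | distRcd _ h₁ h₂ => exact ⟨.and (.rcd h₁) (.rcd h₂), .rcd (.and h₁ h₂)⟩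
  | topRcd => exact ⟨.top, .rcd .top⟩
  | all _ _ ih₁ ih₂ => exact ⟨.all ih₁.2 (ih₂.1.of_length_eq rfl), .all ih₁.1 ih₂.2⟩
  | topAll => exact ⟨.top, .all .top .top⟩
  | distAll _ h₁ h₂ h₃ => exact ⟨.and (.all h₁ h₂) (.all h₁ h₃), .all h₁ (.and h₂ h₃)⟩
  | topVar _ h => exact ⟨.top, .var h⟩

/-- Each distributivity axiom becomes a split on the right followed by a projection on the left for
each half. In `topVar` the bound lies below `Bot`, hence is bottom-like, which places the variable
in `botVars Δ`. -/
theorem Sub.aSub {Δ : TCtx} {A B : Ty} (h : Sub Δ A B) : ASub (botVars Δ) A B := by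
  induction h with
  | refl => exact .refl _ _
  | trans _ _ ih₁ ih₂ => exact ih₁.trans ih₂
  | top => exact .top trivial
  | bot => exact .bot
  | and _ _ ih₁ ih₂ => exact .split (.and _ _) ih₁ ih₂
  | andl => exact .andl (.refl _ _)
  | andr => exact .andr (.refl _ _)
  | arrow _ _ ih₁ ih₂ => exact .arrow ih₁ ih₂
  | distArrow =>
    exact .split (.arrow _ (.and _ _)) (.andl (.refl _ _)) (.andr (.refl _ _))
  | topArrow | topRcd | topAll => exact .top trivial
  | rcd _ ih => exact .rcd ih
  | distRcd => exact .split (.rcd _ (.and _ _)) (.andl (.refl _ _)) (.andr (.refl _ _))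
  | all _ _ ih₁ ih₂ => exact .all ih₁ (by rwa [botVars_cons] at ih₂)
  | distAll => exact .split (.all _ (.and _ _)) (.andl (.refl _ _)) (.andr (.refl _ _))
  | topVar _ h _ ih => exact .top ⟨_, h, ih.botLike .bot⟩

/-! ### Common supertypes of disjoint types -/

/-- The kind of a type that is a base, arrow, record or universal type. -/
def Ty.kind : Ty → ℕ
  | .int => 1
  | .arrow _ _ => 2
  | .rcd _ _ => 3
  | .all _ _ => 4
  | _ => 0

theorem DisjointAx.kind_ne {A B : Ty} (h : DisjointAx A B) :
    A.kind ≠ 0 ∧ B.kind ≠ 0 ∧ A.kind ≠ B.kind := by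
  induction h with
  | symm _ ih => exact ⟨ih.2.1, ih.1, ih.2.2.symm⟩
  | _ => simp [Ty.kind]

/-- Kind `0` collects the types to which no disjointness axiom applies. From any other kind, an
ordinary supertype that is not top-like is reached only by the rule of the same constructor. -/
theorem ASub.kind_eq {T : ℕ → Prop} {A B : Ty} (h : ASub T A B) (hB : Ordinary B)
    (hA : A.kind ≠ 0) : TopIn T B ∨ B.kind = A.kind := by
  cases h with
  | top h => exact .inl h
  | split h => exact (hB.not_split h).elim
  | int | arrow | rcd | all => exact .inr rfl
  | bot | var | andl | andr => exact (hA rfl).elim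

theorem ASub.topIn_of_varBound {Δ : TCtx} {T : ℕ → Prop} {X : ℕ} {A B C : Ty}
    (hT : ∀ X, botVars Δ X → T X) (hX : TMem Δ X A) (hAB : Sub Δ A B) (hC : Ordinary C)
    (h : ASub T (.var X) C) (hBC : ASub T B C) : TopIn T C := by
  cases h with
  | top h => exact h
  | split h => exact (hC.not_split h).elim
  | var =>
    -- Here `C` is `X` itself, so the bound of `X` lies below `X`. Either the bound is bottom-like,
    -- which makes `X` top-like, or `X` is a conjunct of its own bound, which scoping forbids, or
    -- `X` is in `T`.
    obtain h | h | h := ((hAB.aSub.mono hT).trans hBC).var_right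
    · exact hT _ ⟨_, hX, h⟩
    · exact (hX.not_hasConjVar h).elim
    · exact h

/-- The set `T` is allowed to exceed `botVars Δ` because of universal types: the bound in `C` lies
below both bounds being compared, so it may be bottom-like when their intersection is not. -/
theorem TDisjoint.topIn {Δ : TCtx} {A B : Ty} (h : TDisjoint Δ A B) {T : ℕ → Prop}
    (hT : ∀ X, botVars Δ X → T X) {C : Ty} (hC : Ordinary C) (hA : ASub T A C)
    (hB : ASub T B C) : TopIn T C := by
  induction h generalizing T C with
  | ax _ _ _ h =>
    obtain ⟨h₁, h₂, h₃⟩ := h.kind_ne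
    obtain h | h := hA.kind_eq hC h₁
    · exact h
    obtain h' | h' := hB.kind_eq hC h₂
    · exact h'
    exact (h₃ (h.symm.trans h')).elim
  | topl h => exact hA.topIn (h.topIn.mono hT)
  | topr _ h => exact hB.topIn (h.topIn.mono hT)
  | andl hs _ _ ih₁ ih₂ =>
    obtain h | h := hA.split_left hC hs
    exacts [ih₁ hT hC h hB, ih₂ hT hC h hB]
  | andr hs _ _ ih₁ ih₂ =>
    obtain h | h := hB.split_left hC hs
    exacts [ih₁ hT hC hA h, ih₂ hT hC hA h]
  | varl hX h => exact hA.topIn_of_varBound hT hX h hC hB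
  | varr hX h => exact hB.topIn_of_varBound hT hX h hC hA
  | arrow _ _ _ ih =>
    cases hA with
    | top h => exact h
    | split h => exact (hC.not_split h).elim
    | arrow _ hA =>
      cases hB with
      | top h => exact h
      | split h => exact (hC.not_split h).elim
      | arrow _ hB => cases hC with | arrow _ hC => exact (ih hT hC hA hB :)
  | rcdEq _ ih =>
    cases hA with
    | top h => exact h
    | split h => exact (hC.not_split h).elim
    | rcd hA =>
      cases hB with
      | top h => exact h
      | split h => exact (hC.not_split h).elim
      | rcd hB => cases hC with | rcd _ hC => exact (ih hT hC hA hB :)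
  | rcdNeq _ _ _ hl =>
    cases hA with
    | top h => exact h
    | split h => exact (hC.not_split h).elim
    | rcd hA =>
      cases hB with
      | top h => exact h
      | split h => exact (hC.not_split h).elim
      | rcd hB => exact (hl rfl).elim
  | all _ _ _ ih =>
    cases hA with
    | top h => exact h
    | split h => exact (hC.not_split h).elim
    | all hA₁ hA =>
      cases hB with
      | top h => exact h
      | split h => exact (hC.not_split h).elim
      | all hB₁ hB =>
        cases hC with | all _ hC =>
        refine (ih ?_ hC hA hB :)
        rw [botVars_cons]
        refine extVar_mono (fun h => ?_) hT
        cases h with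
        | andl h => exact hA₁.botLike h
        | andr h => exact hB₁.botLike h

/-! ### Casting -/

/-- At an ordinary top-like type the result does not depend on the value: a merge only passes the
cast down to a component, and the remaining rules contradict the hypotheses. -/
theorem Cast.topGen_eq {v v' : Tm} {A : Ty} (h : Cast v A v') (hA : Ordinary A)
    (ht : TopLike [] A) : topGen A = some v' := by
  induction h with
  | int => cases ht
  | top _ _ _ h => exact h
  | mergel _ _ _ ih => exact ih hA ht
  | merger _ _ _ ih => exact ih hA ht
  | anno _ _ h => exact (h ht).elim
  | and hs => exact (hA.not_split hs).elim

theorem Cast.eq_of_topLike {v₁ v₂ v₁' v₂' : Tm} {A : Ty} (h₁ : Cast v₁ A v₁')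
    (h₂ : Cast v₂ A v₂') (hA : Ordinary A) (ht : TopLike [] A) : v₁' = v₂' :=
  Option.some.inj ((h₁.topGen_eq hA ht).symm.trans (h₂.topGen_eq hA ht))

/-- The top-like alternative is needed because the `top` rule relates nothing to the value.
Well-formedness is recorded so that `TopIn.topLike` can later return to `TopLike`. -/
theorem Cast.aSub {v v' : Tm} {A B : Ty} (h : Cast v B v') (hB : Ordinary B) (hv : PType v A) :
    TopLike [] B ∨ TWf [] B ∧ ASub (botVars []) A B := by
  induction h generalizing A with
  | int => cases hv; exact .inr ⟨.int, .int⟩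
  | top _ _ h => exact .inl h
  | mergel _ _ _ ih =>
    cases hv with | merge hv _ => exact (ih hB hv).imp_right (.imp_right .andl)
  | merger _ _ _ ih =>
    cases hv with | merge _ hv => exact (ih hB hv).imp_right (.imp_right .andr)
  | anno _ _ _ h => cases hv; exact .inr ⟨h.wf.2, h.aSub⟩
  | and hs => exact (hB.not_split hs).elim

theorem Consistent.cast_eq {v₁ v₂ v₁' v₂' : Tm} {A : Ty} (h : Consistent v₁ v₂)
    (hA : Ordinary A) (h₁ : Cast v₁ A v₁') (h₂ : Cast v₂ A v₂') : v₁' = v₂' := by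
  induction h generalizing v₁' v₂' with
  | lit i =>
    cases h₁ with
    | top _ _ h hg => exact Option.some.inj (hg.symm.trans (h₂.topGen_eq hA h))
    | and hs => exact (hA.not_split hs).elim
    | int =>
      cases h₂ with
      | top _ _ h => cases h
      | and hs => exact (hA.not_split hs).elim
      | int => rfl
  -- Outside the top-like case a cast discards the old annotation, so the two results agree even
  -- when `B` and `C` differ.
  | anno e B C =>
    by_cases ht : TopLike [] A
    · exact h₁.eq_of_topLike h₂ hA ht
    cases h₁ with
    | top _ _ h => exact (ht h).elim
    | and hs => exact (hA.not_split hs).elim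
    | anno =>
      cases h₂ with
      | top _ _ h => exact (ht h).elim
      | and hs => exact (hA.not_split hs).elim
      | anno => rfl
  | disjoint hv₁ hv₂ hd =>
    refine h₁.eq_of_topLike h₂ hA ?_
    obtain h | ⟨hw, hs₁⟩ := h₁.aSub hA hv₁
    · exact h
    obtain h | ⟨-, hs₂⟩ := h₂.aSub hA hv₂
    · exact h
    exact (hd.topIn (fun _ => id) hA hs₁ hs₂).topLike .empty hw
  | mergel _ _ ih₁ ih₂ =>
    cases h₁ with
    | top hv hA ht hg => exact (Cast.top hv hA ht hg).eq_of_topLike h₂ hA ht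
    | and hs => exact (hA.not_split hs).elim
    | mergel _ _ h => exact ih₁ h h₂
    | merger _ _ h => exact ih₂ h h₂
  | merger _ _ ih₁ ih₂ =>
    cases h₂ with
    | top hv hA ht hg => exact h₁.eq_of_topLike (Cast.top hv hA ht hg) hA ht
    | and hs => exact (hA.not_split hs).elim
    | mergel _ _ h => exact ih₁ h₁ h
    | merger _ _ h => exact ih₂ h₁ h

theorem PreValue.pType {u : Tm} {A : Ty} {Δ : TCtx} {Γ : Ctx} (hu : PreValue u)
    (h : Typing Δ Γ u .inf A) : PType u A := by
  induction hu generalizing Δ Γ A with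
  | lit => cases h; exact .lit _
  | top => cases h; exact .top
  | anno => cases h; exact .anno _ _
  | merge _ _ ih₁ ih₂ =>
    cases h with
    | merge h₁ h₂ => exact .merge (ih₁ h₁) (ih₂ h₂)
    | mergev _ _ _ _ h₁ h₂ => exact .merge (ih₁ h₁) (ih₂ h₂)

/-- The components of a well-typed closed merge of pre-values are well-typed and consistent. -/
theorem PreValue.consistent {u₁ u₂ : Tm} {A : Ty} (hu₁ : PreValue u₁) (hu₂ : PreValue u₂)
    (h : Typing [] [] (.merge u₁ u₂) .inf A) :
    (∃ A₁, Typing [] [] u₁ .inf A₁) ∧ (∃ A₂, Typing [] [] u₂ .inf A₂) ∧ Consistent u₁ u₂ := by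
  cases h with
  | merge h₁ h₂ hd => exact ⟨⟨_, h₁⟩, ⟨_, h₂⟩, .disjoint (hu₁.pType h₁) (hu₂.pType h₂) hd⟩
  | mergev _ _ _ _ h₁ h₂ hc => exact ⟨⟨_, h₁⟩, ⟨_, h₂⟩, hc⟩

theorem Cast.unique {v v₁ v₂ : Tm} {A B : Ty} (hv : PreValue v)
    (ht : Typing [] [] v .inf B) (h₁ : Cast v A v₁) (h₂ : Cast v A v₂) : v₁ = v₂ := by
  induction h₁ generalizing B v₂ with
  | int =>
    cases h₂ with
    | int => rfl
    | top _ _ h => cases h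
    | and hs => cases hs
  | top hv' hA htop hg => exact (Cast.top hv' hA htop hg).eq_of_topLike h₂ hA htop
  | mergel hw hA h₁ ih =>
    cases hv with | merge hu₁ hu₂ =>
    obtain ⟨⟨_, ht₁⟩, ⟨_, ht₂⟩, hc⟩ := hu₁.consistent hu₂ ht
    cases h₂ with
    | top hv' hA htop hg => exact h₁.eq_of_topLike (Cast.top hv' hA htop hg) hA htop
    | and hs => exact (hA.not_split hs).elim
    | mergel _ _ h => exact ih hu₁ ht₁ h
    -- The two casts selected different components; consistency reconciles them.
    | merger _ _ h => exact hc.cast_eq hA h₁ h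
  | merger hw hA h₁ ih =>
    cases hv with | merge hu₁ hu₂ =>
    obtain ⟨⟨_, ht₁⟩, ⟨_, ht₂⟩, hc⟩ := hu₁.consistent hu₂ ht
    cases h₂ with
    | top hv' hA htop hg => exact h₁.eq_of_topLike (Cast.top hv' hA htop hg) hA htop
    | and hs => exact (hA.not_split hs).elim
    | mergel _ _ h => exact (hc.cast_eq hA h h₁).symm
    | merger _ _ h => exact ih hu₂ ht₂ h
  | anno _ hA hn =>
    cases h₂ with
    | top _ _ h => exact (hn h).elim
    | and hs => exact (hA.not_split hs).elim
    | anno => rfl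
  | and hs _ _ ih₁ ih₂ =>
    cases h₂ with
    | int => cases hs
    | top _ hA | mergel _ hA | merger _ hA | anno _ hA => exact (hA.not_split hs).elim
    | and hs' h h' =>
      obtain ⟨rfl, rfl⟩ := hs.unique hs'
      rw [ih₁ hv ht h, ih₂ hv ht h']

/-! ### Wrapping and parallel application -/

theorem Wrap.unique {e u u' : Tm} {A : Ty} (h : Wrap e A u) (h' : Wrap e A u') : u = u' := by
  induction h generalizing u' with
  | top hA ht hg =>
    cases h' with
    | top _ _ hg' => exact Option.some.inj (hg.symm.trans hg')
    | anno _ hn => exact (hn ht).elim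
    | and hs => exact (hA.not_split hs).elim
  | anno hA hn =>
    cases h' with
    | top _ ht => exact (hn ht).elim
    | anno => rfl
    | and hs => exact (hA.not_split hs).elim
  | and hs _ _ ih₁ ih₂ =>
    cases h' with
    | top hA | anno hA => exact (hA.not_split hs).elim
    | and hs' h h' =>
      obtain ⟨rfl, rfl⟩ := hs.unique hs'
      rw [ih₁ h, ih₂ h']

/-- An intersection also distributes to itself by `refl`, but that result is not an arrow. Fixing
the shape of the result leaves a single applicable rule for each `A`. -/
theorem AppDist.arrow_unique {A B C B' C' : Ty} (h : AppDist A (.arrow B C))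
    (h' : AppDist A (.arrow B' C')) : B = B' ∧ C = C' := by
  induction A generalizing B C B' C' with
  | and _ _ ih₁ ih₂ =>
    cases h with | andArrow h₁ h₂ =>
    cases h' with | andArrow h₁' h₂' =>
    obtain ⟨rfl, rfl⟩ := ih₁ h₁ h₁'
    obtain ⟨rfl, rfl⟩ := ih₂ h₂ h₂'
    exact ⟨rfl, rfl⟩
  | _ => cases h; try (cases h'; exact ⟨rfl, rfl⟩)

theorem AppDist.rcd_unique {A B B' : Ty} {l : Label} (h : AppDist A (.rcd l B))
    (h' : AppDist A (.rcd l B')) : B = B' := by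
  induction A generalizing B B' with
  | and _ _ ih₁ ih₂ =>
    cases h with | andRcd h₁ h₂ =>
    cases h' with | andRcd h₁' h₂' =>
    rw [ih₁ h₁ h₁', ih₂ h₂ h₂']
  | _ => cases h; try (cases h'; rfl)

theorem AppDist.all_unique {A B C B' C' : Ty} (h : AppDist A (.all B C))
    (h' : AppDist A (.all B' C')) : B = B' ∧ C = C' := by
  induction A generalizing B C B' C' with
  | and _ _ ih₁ ih₂ =>
    cases h with | andAll h₁ h₂ =>
    cases h' with | andAll h₁' h₂' =>
    obtain ⟨rfl, rfl⟩ := ih₁ h₁ h₁'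
    obtain ⟨rfl, rfl⟩ := ih₂ h₂ h₂'
    exact ⟨rfl, rfl⟩
  | _ => cases h; try (cases h'; exact ⟨rfl, rfl⟩)

theorem PApp.unique {v u u' : Tm} {a : Arg} (h : PApp v a u) (h' : PApp v a u') : u = u' := by
  induction h generalizing u' with
  | abs hd hw =>
    cases h' with | abs hd' hw' =>
    obtain ⟨rfl, rfl⟩ := hd.arrow_unique hd'
    rw [hw.unique hw']
  | tabs hd =>
    cases h' with | tabs hd' =>
    obtain ⟨rfl, rfl⟩ := hd.all_unique hd'
    rfl
  | proj hd =>
    cases h' with | proj hd' => rw [hd.rcd_unique hd']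
  | merge _ _ _ _ ih₁ ih₂ =>
    cases h' with | merge _ _ h h' => rw [ih₁ h, ih₂ h']

/-! ### Reduction -/

theorem Checkable.not_step {p e : Tm} (hp : Checkable p) (h : Step p e) : False := by
  cases hp <;> cases h

theorem Checkable.not_preValue {p : Tm} (hp : Checkable p) (h : PreValue p) : False := by
  cases hp <;> cases h

theorem Value.not_step {v e : Tm} (hv : Value v) (h : Step v e) : False := by
  induction hv generalizing e with
  | chk hp => exact hp.not_step h
  | anno A hp =>
    cases h with
    -- The pre-value condition in the cast rule separates the value `p : A` from a redex.
    | annov _ h => exact hp.not_preValue h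
    | cntxAnno h => exact hp.not_step h
  | lit | top => cases h
  | merge _ _ ih₁ ih₂ =>
    cases h with
    | merge h => exact ih₁ h
    | cntxMergel _ h => exact ih₁ h
    | cntxMerger _ h => exact ih₂ h

/-- An annotated term is only checked, while induction on reduction needs synthesis. Only checkable
terms have checking rules of their own; any other term is checked through subsumption or `inter`, so
a synthesis derivation lies underneath. -/
theorem Typing.exists_inf {Δ : TCtx} {Γ : Ctx} {e : Tm} {m : Mode} {A : Ty}
    (h : Typing Δ Γ e m A) (he : ¬ Checkable e) : ∃ B, Typing Δ Γ e .inf B := by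
  induction h with
  | abs => exact (he (.lam _ _)).elim
  | tabs => exact (he (.tlam _)).elim
  | rcd => exact (he (.rcd _ _)).elim
  | inter _ _ ih => exact ih he
  | sub h => exact ⟨_, h⟩
  | top h h' => exact ⟨_, .top h h'⟩
  | lit i h h' => exact ⟨_, .lit i h h'⟩
  | var h h' h'' => exact ⟨_, .var h h' h''⟩
  | app h h' h'' => exact ⟨_, .app h h' h''⟩
  | tapp h h' h'' => exact ⟨_, .tapp h h' h''⟩
  | proj h h' => exact ⟨_, .proj h h'⟩
  | merge h h' h'' => exact ⟨_, .merge h h' h''⟩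
  | mergev h₁ h₂ h₃ h₄ h₅ h₆ h₇ => exact ⟨_, .mergev h₁ h₂ h₃ h₄ h₅ h₆ h₇⟩
  | fix h => exact ⟨_, .fix h⟩
  | anno h => exact ⟨_, .anno h⟩

theorem Typing.merge_inv {e₁ e₂ : Tm} {A : Ty} (h : Typing [] [] (.merge e₁ e₂) .inf A) :
    (∃ A₁, Typing [] [] e₁ .inf A₁) ∧ ∃ A₂, Typing [] [] e₂ .inf A₂ := by
  cases h with
  | merge h₁ h₂ => exact ⟨⟨_, h₁⟩, ⟨_, h₂⟩⟩
  | mergev _ _ _ _ h₁ h₂ => exact ⟨⟨_, h₁⟩, ⟨_, h₂⟩⟩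

theorem Step.unique {e e₁ e₂ : Tm} {A : Ty} (ht : Typing [] [] e .inf A) (h₁ : Step e e₁)
    (h₂ : Step e e₂) : e₁ = e₂ := by
  induction h₁ generalizing A e₂ with
  | papp hv h =>
    cases h₂ with
    | papp _ h' => exact h.unique h'
    | cntxApp h' => exact (hv.not_step h').elim
  | pproj hv h =>
    cases h₂ with
    | pproj _ h' => exact h.unique h'
    | cntxProj h' => exact (hv.not_step h').elim
  | ptapp hv h =>
    cases h₂ with
    | ptapp _ h' => exact h.unique h'
    | cntxTapp h' => exact (hv.not_step h').elim
  | fix => cases h₂; rfl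
  | annov hv hu h =>
    cases h₂ with
    | annov _ _ h' =>
      cases ht with | anno ht =>
      obtain ⟨_, ht⟩ := ht.exists_inf fun hp => hp.not_preValue hu
      exact h.unique hu ht h'
    | cntxAnno h' => exact (hv.not_step h').elim
  -- The three rules for merges exclude one another: both components step, or exactly one steps and
  -- the other is a value.
  | merge h h' ih₁ ih₂ =>
    obtain ⟨⟨_, ht₁⟩, ⟨_, ht₂⟩⟩ := ht.merge_inv
    cases h₂ with
    | merge k k' => rw [ih₁ ht₁ k, ih₂ ht₂ k']
    | cntxMergel hv => exact (hv.not_step h').elim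
    | cntxMerger hv => exact (hv.not_step h).elim
  | cntxApp h ih =>
    cases h₂ with
    | papp hv => exact (hv.not_step h).elim
    | cntxApp h' => cases ht with | app ht => rw [ih ht h']
  | cntxTapp h ih =>
    cases h₂ with
    | ptapp hv => exact (hv.not_step h).elim
    | cntxTapp h' => cases ht with | tapp ht => rw [ih ht h']
  | cntxProj h ih =>
    cases h₂ with
    | pproj hv => exact (hv.not_step h).elim
    | cntxProj h' => cases ht with | proj ht => rw [ih ht h']
  | cntxMergel hv h ih =>
    obtain ⟨⟨_, ht₁⟩, -⟩ := ht.merge_inv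
    cases h₂ with
    | merge _ h' => exact (hv.not_step h').elim
    | cntxMergel _ h' => rw [ih ht₁ h']
    | cntxMerger _ h' => exact (hv.not_step h').elim
  | cntxMerger hv h ih =>
    obtain ⟨-, _, ht₂⟩ := ht.merge_inv
    cases h₂ with
    | merge h' => exact (hv.not_step h').elim
    | cntxMergel _ h' => exact (hv.not_step h').elim
    | cntxMerger _ h' => rw [ih ht₂ h']
  | cntxAnno h ih =>
    cases h₂ with
    | annov hv => exact (hv.not_step h).elim
    | cntxAnno h' =>
      cases ht with | anno ht =>
      -- A term that steps is not checkable, so the checked body also synthesizes a type and the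
      -- induction hypothesis applies.
      obtain ⟨_, ht⟩ := ht.exists_inf fun hp => hp.not_step h
      rw [ih ht h']

end FiPlus

/-- Determinism of reduction for well-typed closed terms. -/
theorem mainTheorem1 (e e₁ e₂ : FiPlus.Tm) (A : FiPlus.Ty)
    (he : FiPlus.Typing [] [] e FiPlus.Mode.inf A)
    (h₁ : FiPlus.Step e e₁) (h₂ : FiPlus.Step e e₂) : e₁ = e₂ :=
  h₁.unique he h₂
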